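/- Let $d\ge 2$, let $C\subset\mathbb R^d$ be a closed convex cone with apex at the origin which is pointed ($C\cap(-C)=\{0\}$) and has interior points, let $C^\circ=\{x\in\mathbb R^d:\langle x,y\rangle\le 0\ \text{for all } y\in C\}$ be its polar cone, and let $\Omega_C=\mathbb S^{d-1}\cap\operatorname{int}C^\circ$. A nonempty closed convex set $K\subset C$ is called $C$-asymptotic if for $x\in\operatorname{bd}C$ the distance of $x$ from $K$ tends to $0$ as $\|x\|\to\infty$. The surface area measure of $K$ assigns to each Borel set $\omega\subset\Omega_C$ the value $S_{d-1}(K,\omega)=\mathcal H^{d-1}(\tau(K,\omega))$, where $\tau(K,\omega)$ is the set of all boundary points of $K$ at which there is an outer normal vector belonging to $\omega$, and $\mathcal H^{d-1}$ is $(d-1)$-dimensional Hausdorff measure. For nonempty compact $\omega\subset\Omega_C$, let $\Delta(\omega)$ be the smallest angle between a vector $u\in\omega$ and a vector $v$ in the boundary of $\Omega_C$ relative to $\mathbb S^{d-1}$; put $\Delta(\emptyset)=0$. **Theorem 4.1.** Let $\varphi$ be a Borel measure on $\Omega_C$. If $\varphi$ is the surface area measure of some $C$-asymptotic set $K$, that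 is, $\varphi(\omega)=S_{d-1}(K,\omega)$ for all Borel sets $\omega\subset\Omega_C$, then the function $\omega\mapsto\Delta(\omega)^{d-1}\varphi(\omega)$ is bounded on the compact subsets $\omega$ of $\Omega_C$: there is a constant $M<\infty$ with $\Delta(\omega)^{d-1}\varphi(\omega)\le M$ for all compact $\omega\subset\Omega_C$. In particular, finiteness on compact sets is not sufficient: for each such $C$ there is a Borel measure on $\Omega_C$ which is finite on every compact subset of $\Omega_C$ but is not the surface area measure of any $C$-asymptotic set. -/

import Mathlib

open MeasureTheory Filter Topology
open scoped NNReal ENNReal RealInnerProductSpace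

noncomputable section

/-- The polar cone `{x | ⟪x, y⟫ ≤ 0 for all y ∈ C}` of a set `C ⊆ ℝᵈ`. -/
def polarCone {d : ℕ} (C : Set (EuclideanSpace ℝ (Fin d))) : Set (EuclideanSpace ℝ (Fin d)) :=
  {x | ∀ y ∈ C, ⟪x, y⟫ ≤ 0}

/-- `Ω_C`, the intersection of the unit sphere with the interior of the polar cone of `C`,
as a subset of the unit sphere (with the sphere's own topology). -/
def sphOmega {d : ℕ} (C : Set (EuclideanSpace ℝ (Fin d))) :
    Set (Metric.sphere (0 : EuclideanSpace ℝ (Fin d)) 1) :=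
  {u | (u : EuclideanSpace ℝ (Fin d)) ∈ interior (polarCone C)}

/-- `K` is a `C`-asymptotic convex set: a nonempty closed convex subset of `C` such that the
distance from `x` to `K` tends to zero as `‖x‖ → ∞` with `x` in the boundary of `C`. -/
structure IsConeAsymptotic {d : ℕ} (C K : Set (EuclideanSpace ℝ (Fin d))) : Prop where
  nonempty : K.Nonempty
  isClosed : IsClosed K
  convex : Convex ℝ K
  subset : K ⊆ C
  tendsto_infDist :
    Tendsto (fun x => Metric.infDist x K) (comap norm atTop ⊓ 𝓟 (frontier C)) (𝓝 0)

/-- The reverse spherical image of `K` at a set `ω` of unit vectors: the boundary points of `K`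
at which there is an outer normal vector in `ω`. -/
def reverseSphericalImage {d : ℕ} (K : Set (EuclideanSpace ℝ (Fin d)))
    (ω : Set (Metric.sphere (0 : EuclideanSpace ℝ (Fin d)) 1)) :
    Set (EuclideanSpace ℝ (Fin d)) :=
  {x | x ∈ frontier K ∧
    ∃ u ∈ ω, ∀ y ∈ K, ⟪y, (u : EuclideanSpace ℝ (Fin d))⟫ ≤ ⟪x, (u : EuclideanSpace ℝ (Fin d))⟫}

/-- The surface area of `K` at `ω`: the `(d-1)`-dimensional Hausdorff measure (normalized so as to
agree with Lebesgue measure on `ℝᵈ⁻¹`) of the reverse spherical image. -/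
def surfaceArea {d : ℕ} (K : Set (EuclideanSpace ℝ (Fin d)))
    (ω : Set (Metric.sphere (0 : EuclideanSpace ℝ (Fin d)) 1)) : ℝ≥0∞ :=
  μHE[d - 1] (reverseSphericalImage K ω)

/-- The Borel measure `φ` on `Ω_C` is the surface area measure of `K`. -/
def IsSurfaceAreaMeasure {d : ℕ} (C K : Set (EuclideanSpace ℝ (Fin d)))
    (φ : Measure (sphOmega C)) : Prop :=
  ∀ ω : Set (sphOmega C), MeasurableSet ω → φ ω = surfaceArea K (Subtype.val '' ω)

/-- The angular distance of `ω ⊆ Ω_C` from the boundary of `Ω_C` relative to the unit sphere: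
the infimum of the angles between a vector of `ω` and a vector of this boundary. (This is a
minimum if `ω` is compact and nonempty and the boundary is nonempty; it is `0` if `ω = ∅`.) -/
def angularDist {d : ℕ} (C : Set (EuclideanSpace ℝ (Fin d))) (ω : Set (sphOmega C)) : ℝ :=
  sInf {θ : ℝ | ∃ u ∈ ω, ∃ v ∈ frontier (sphOmega C),
    θ = InnerProductGeometry.angle (u.1.1 : EuclideanSpace ℝ (Fin d)) v.1}

end

/-!
Let `p ∈ K`, let `ω ⊆ Ω_C` and `Δ = angularDist C ω`. Both the size of the reverse spherical image
of `K` at `ω` and its shape are controlled by the position of its normal vectors relative to `C`.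

* *Size.* If `u ∈ ω` and `0 ≠ x ∈ C`, then the great circle arc that starts at `u` towards `x` meets
  `xᗮ`, hence leaves `Ω_C`, after the length `angle u x - π / 2`
  (`exists_mem_frontier_sphOmega_angle_le`). So `Δ ≤ angle u x - π / 2`, whence
  `⟪x, u⟫ ≤ -(2 / π) * Δ * ‖x‖`. If `u` is an outer normal vector of `K` at `x`, then also
  `-‖p‖ ≤ ⟪p, u⟫ ≤ ⟪x, u⟫`. Thus `‖x‖` is at most a constant multiple of `1 / Δ`.
* *Shape.* All outer normal vectors `u` in question are unit vectors of the polar cone, so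
  `⟪w, u⟫ ≤ -r` if the ball with centre `w` and radius `r` lies in `C`. Therefore the boundary points
  of `K` having such a normal vector form a Lipschitz graph over the hyperplane `wᗮ`
  (`norm_sub_le_mul_norm_orthogonalProjectionOnto`), and the area of the part of the graph with
  `‖x‖ ≤ R` is at most a constant multiple of `R ^ (d - 1)`
  (`euclideanHausdorffMeasure_le_of_antilipschitz`).

Together this bounds `Δ ^ (d - 1)` times the surface area (`exists_angularDist_pow_mul_surfaceArea_le`);
only that `K` is a nonempty closed subset of `C` matters.

For the second claim, take points `u n ∈ Ω_C` converging to a boundary point of `Ω_C`, and put the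
mass `n / angularDist C {u n} ^ (d - 1)` at `u n`. A compact subset of `Ω_C` contains `u n` for
finitely many `n` only, so it has finite measure, while the bound of the first claim fails on
the singletons `{u n}`.
-/

/-! ### Polar cones -/

/-- A quantitative form of strict negativity: a linear functional that is nonpositive on a ball of
radius `r` is at most `-r` times its norm at the centre. -/
theorem inner_le_neg_mul_norm_of_closedBall {E : Type*} [NormedAddCommGroup E]
    [InnerProductSpace ℝ E] {z x : E} {r : ℝ} (hr : 0 ≤ r)
    (h : ∀ y ∈ Metric.closedBall z r, ⟪y, x⟫ ≤ 0) : ⟪z, x⟫ ≤ -r * ‖x‖ := by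
  rcases eq_or_ne x 0 with rfl | hx
  · simp
  have hx' : 0 < ‖x‖ := norm_pos_iff.2 hx
  have h1 := h (z + (r / ‖x‖) • x) (by
    simp [norm_smul, abs_of_nonneg hr, div_mul_cancel₀ _ hx'.ne'])
  rw [inner_add_left, real_inner_smul_left, real_inner_self_eq_norm_sq] at h1
  have : r / ‖x‖ * ‖x‖ ^ 2 = r * ‖x‖ := by field_simp
  linarith

theorem inner_neg_of_mem_interior_polarCone {d : ℕ} {C : Set (EuclideanSpace ℝ (Fin d))}
    {u x : EuclideanSpace ℝ (Fin d)} (hu : u ∈ interior (polarCone C)) (hx : x ∈ C)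
    (hx0 : x ≠ 0) : ⟪u, x⟫ < 0 := by
  obtain ⟨r, hr, hb⟩ := Metric.nhds_basis_closedBall.mem_iff.1 (mem_interior_iff_mem_nhds.1 hu)
  have h := inner_le_neg_mul_norm_of_closedBall (x := x) hr.le fun y hy => hb hy x hx
  have : 0 < r * ‖x‖ := mul_pos hr (norm_pos_iff.2 hx0)
  linarith

theorem convex_polarCone {d : ℕ} (C : Set (EuclideanSpace ℝ (Fin d))) :
    Convex ℝ (polarCone C) := by
  intro x hx y hy a b ha hb _ z hz
  rw [inner_add_left, real_inner_smul_left, real_inner_smul_left]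
  exact add_nonpos (mul_nonpos_of_nonneg_of_nonpos ha (hx z hz))
    (mul_nonpos_of_nonneg_of_nonpos hb (hy z hz))

theorem smul_mem_polarCone {d : ℕ} (C : Set (EuclideanSpace ℝ (Fin d))) {c : ℝ} (hc : 0 ≤ c)
    {x : EuclideanSpace ℝ (Fin d)} (hx : x ∈ polarCone C) : c • x ∈ polarCone C := by
  intro z hz
  rw [real_inner_smul_left]
  exact mul_nonpos_of_nonneg_of_nonpos hc (hx z hz)

/-- The polar of a pointed cone has interior points: otherwise it would lie in a hyperplane, and by
the bipolar theorem the cone would contain the line orthogonal to this hyperplane. -/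
theorem nonempty_interior_polarCone {d : ℕ} (C : ProperCone ℝ (EuclideanSpace ℝ (Fin d)))
    (hpointed : ∀ x ∈ C, -x ∈ C → x = 0) :
    (interior (polarCone (C : Set (EuclideanSpace ℝ (Fin d))))).Nonempty := by
  set P := polarCone (C : Set (EuclideanSpace ℝ (Fin d))) with hP
  have h0 : (0 : EuclideanSpace ℝ (Fin d)) ∈ P := fun y _ => by simp
  rw [(convex_polarCone _).interior_nonempty_iff_affineSpan_eq_top]
  suffices h : Submodule.span ℝ P = ⊤ by
    apply SetLike.coe_injective
    have := affineSpan_insert_zero (k := ℝ) P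
    rw [Set.insert_eq_of_mem h0] at this
    rw [this, h]
    rfl
  rw [← Submodule.orthogonal_eq_bot_iff, Submodule.eq_bot_iff]
  have key : ∀ w ∈ (Submodule.span ℝ P)ᗮ, w ∈ C := by
    intro w hw
    by_contra hwC
    obtain ⟨y, hy, hwy⟩ := ProperCone.hyperplane_separation' C hwC
    have hyP : -y ∈ P := fun x hx => by
      have := hy x hx
      rw [inner_neg_left, real_inner_comm]
      linarith
    have := (Submodule.mem_orthogonal _ _).1 hw _ (Submodule.subset_span hyP)
    rw [inner_neg_left, real_inner_comm] at this
    linarith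
  exact fun w hw => hpointed w (key w hw) (key _ (Submodule.neg_mem _ hw))

theorem isOpen_sphOmega {d : ℕ} (C : Set (EuclideanSpace ℝ (Fin d))) : IsOpen (sphOmega C) :=
  isOpen_interior.preimage continuous_subtype_val

open scoped Pointwise in
theorem nonempty_sphOmega {d : ℕ} (C : ProperCone ℝ (EuclideanSpace ℝ (Fin d)))
    (hpointed : ∀ x ∈ C, -x ∈ C → x = 0) {x : EuclideanSpace ℝ (Fin d)} (hx : x ∈ C)
    (hx0 : x ≠ 0) : (sphOmega (C : Set (EuclideanSpace ℝ (Fin d)))).Nonempty := by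
  obtain ⟨z, hz⟩ := nonempty_interior_polarCone C hpointed
  have hz0 : z ≠ 0 := by
    rintro rfl
    simpa using inner_neg_of_mem_interior_polarCone hz hx hx0
  have hz1 : 0 < ‖z‖ := norm_pos_iff.2 hz0
  refine ⟨⟨‖z‖⁻¹ • z, by simp [norm_smul, hz1.ne']⟩, ?_⟩
  have h1 : ‖z‖⁻¹ • z ∈ ‖z‖⁻¹ • interior (polarCone (C : Set (EuclideanSpace ℝ (Fin d)))) :=
    Set.smul_mem_smul_set hz
  rw [← interior_smul₀ (inv_ne_zero hz1.ne')] at h1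
  refine interior_mono ?_ h1
  rintro _ ⟨y, hy, rfl⟩
  exact smul_mem_polarCone _ (by positivity) hy

/-- In dimension at least two, a set with interior points has a nonzero element. -/
theorem exists_ne_zero_mem_of_nonempty_interior {d : ℕ} (hd : 2 ≤ d)
    {C : Set (EuclideanSpace ℝ (Fin d))} (hint : (interior C).Nonempty) : ∃ x ∈ C, x ≠ 0 := by
  have : Nonempty (Fin d) := ⟨⟨0, by omega⟩⟩
  by_contra! h
  have h1 : C ⊆ {0} := fun x hx => h x hx
  have h2 := hint.mono (interior_mono h1)
  simp [interior_singleton] at h2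

/-! ### The angular distance -/

/-- Every vector is in the plane of a given unit vector `u` and some unit vector `e` orthogonal to
`u`, on the side of `e`. -/
theorem exists_orthonormal_decomposition {d : ℕ} (hd : 2 ≤ d)
    {u : EuclideanSpace ℝ (Fin d)} (hu : ‖u‖ = 1) (x : EuclideanSpace ℝ (Fin d)) :
    ∃ (e : EuclideanSpace ℝ (Fin d)) (a b : ℝ), ‖e‖ = 1 ∧ ⟪u, e⟫ = 0 ∧ 0 ≤ b ∧
      x = a • u + b • e := by
  have huu : ⟪u, u⟫ = 1 := by rw [real_inner_self_eq_norm_sq, hu]; norm_num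
  -- if `x` is a multiple of `u`, any unit vector orthogonal to `u` serves as `e`
  by_cases h : x - ⟪u, x⟫ • u = 0
  · have hu0 : u ≠ 0 := by rintro rfl; simp at hu
    have : Fact (Module.finrank ℝ (EuclideanSpace ℝ (Fin d)) = (d - 1) + 1) :=
      ⟨by simp; omega⟩
    have hf : Module.finrank ℝ (ℝ ∙ u)ᗮ = d - 1 :=
      Submodule.finrank_orthogonal_span_singleton hu0
    have : Nontrivial (ℝ ∙ u)ᗮ := Module.nontrivial_of_finrank_pos (R := ℝ) (by omega)
    obtain ⟨e, he⟩ := exists_norm_eq (ℝ ∙ u)ᗮ (zero_le_one (α := ℝ))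
    refine ⟨e, ⟪u, x⟫, 0, he, ?_, le_rfl, by simpa [sub_eq_zero] using h⟩
    exact Submodule.mem_orthogonal_singleton_iff_inner_right.1 e.2
  · have hn := norm_pos_iff.2 h
    refine ⟨‖x - ⟪u, x⟫ • u‖⁻¹ • (x - ⟪u, x⟫ • u), ⟪u, x⟫, ‖x - ⟪u, x⟫ • u‖, ?_, ?_,
      norm_nonneg _, ?_⟩
    · rw [norm_smul, norm_inv, norm_norm, inv_mul_cancel₀ hn.ne']
    · rw [real_inner_smul_right, inner_sub_right, real_inner_smul_right, huu]
      simp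
    · rw [smul_inv_smul₀ hn.ne']
      abel

/-- On the great circle arc from `u ∈ Ω_C` towards `x ∈ C`, the boundary of `Ω_C` is reached no later
than the point orthogonal to `x`. -/
theorem exists_mem_frontier_sphOmega_angle_le {d : ℕ} (hd : 2 ≤ d)
    {C : Set (EuclideanSpace ℝ (Fin d))} {u : Metric.sphere (0 : EuclideanSpace ℝ (Fin d)) 1}
    (hu : u ∈ sphOmega C) {x : EuclideanSpace ℝ (Fin d)} (hx : x ∈ C) (hx0 : x ≠ 0) :
    ∃ v ∈ frontier (sphOmega C), InnerProductGeometry.angle (u : EuclideanSpace ℝ (Fin d)) v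
      ≤ InnerProductGeometry.angle (u : EuclideanSpace ℝ (Fin d)) x - Real.pi / 2 := by
  have hu1 : ‖(u : EuclideanSpace ℝ (Fin d))‖ = 1 := by simp
  have hux : ⟪(u : EuclideanSpace ℝ (Fin d)), x⟫ < 0 :=
    inner_neg_of_mem_interior_polarCone hu hx hx0
  obtain ⟨e, a, b, he, hue, hb, hxe⟩ := exists_orthonormal_decomposition hd hu1 x
  set v : EuclideanSpace ℝ (Fin d) := u.1 with hv
  have hvv : ⟪v, v⟫ = 1 := by rw [real_inner_self_eq_norm_sq, hu1]; norm_num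
  have hee : ⟪e, e⟫ = 1 := by rw [real_inner_self_eq_norm_sq, he]; norm_num
  have hev : ⟪e, v⟫ = 0 := by rw [real_inner_comm]; exact hue
  have hxn : 0 < ‖x‖ := norm_pos_iff.2 hx0
  set α := InnerProductGeometry.angle v x with hα
  have hva : ⟪v, x⟫ = a := by
    rw [hxe, inner_add_right, real_inner_smul_right, real_inner_smul_right, hvv, hue]; ring
  have hea : ⟪e, x⟫ = b := by
    rw [hxe, inner_add_right, real_inner_smul_right, real_inner_smul_right, hev, hee]; ring
  have hxx : ⟪x, x⟫ = a * a + b * b := by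
    nth_rw 1 [hxe]
    rw [inner_add_left, real_inner_smul_left, real_inner_smul_left, hva, hea]
  have hcos : Real.cos α * ‖x‖ = a := by
    have := InnerProductGeometry.cos_angle_mul_norm_mul_norm v x
    rwa [hu1, one_mul, hva] at this
  have hsin : Real.sin α * ‖x‖ = b := by
    have := InnerProductGeometry.sin_angle_mul_norm_mul_norm v x
    rw [hu1, one_mul, hva, hvv, hxx] at this
    rw [this, show 1 * (a * a + b * b) - a * a = b ^ 2 by ring, Real.sqrt_sq hb]
  have hα1 : Real.pi / 2 < α := by
    by_contra! h
    have h1 := Real.cos_nonneg_of_neg_pi_div_two_le_of_le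
      (by linarith [InnerProductGeometry.angle_nonneg v x, Real.pi_pos]) h
    have := mul_nonneg h1 hxn.le
    linarith
  have hα2 : α ≤ Real.pi := InnerProductGeometry.angle_le_pi v x
  -- the great circle arc from `u` in the direction of `x`
  let γ : ℝ → Metric.sphere (0 : EuclideanSpace ℝ (Fin d)) 1 := fun t =>
    ⟨Real.cos t • v + Real.sin t • e, by
      rw [mem_sphere_zero_iff_norm, ← sq_eq_sq₀ (norm_nonneg _) zero_le_one,
        ← real_inner_self_eq_norm_sq, inner_add_left, inner_add_right, inner_add_right]
      simp only [real_inner_smul_left, real_inner_smul_right, hvv, hue, hee, hev]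
      nlinarith [Real.sin_sq_add_cos_sq t]⟩
  have hγ : Continuous γ := by
    refine Continuous.subtype_mk ?_ _
    fun_prop
  set T := α - Real.pi / 2 with hT
  have hend : γ T ∉ sphOmega C := by
    intro h
    have h1 : ⟪Real.cos T • v + Real.sin T • e, x⟫ < 0 :=
      inner_neg_of_mem_interior_polarCone h hx hx0
    rw [inner_add_left, real_inner_smul_left, real_inner_smul_left, hva, hea, hT,
      Real.cos_sub_pi_div_two, Real.sin_sub_pi_div_two, ← hcos, ← hsin] at h1
    apply h1.ne
    ring
  have hex : ∃ t ∈ Set.Icc 0 T, γ t ∈ frontier (sphOmega C) := by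
    by_contra! h
    have hsub : γ '' Set.Icc 0 T ⊆ sphOmega C := by
      refine IsPreconnected.subset_left_of_subset_union (v := (closure (sphOmega C))ᶜ)
        (isOpen_sphOmega C) isClosed_closure.isOpen_compl
        (Set.disjoint_compl_right_iff_subset.2 subset_closure) ?_ ?_
        (isPreconnected_Icc.image γ hγ.continuousOn)
      · rintro _ ⟨t, ht, rfl⟩
        by_cases h1 : γ t ∈ sphOmega C
        · exact Or.inl h1
        · refine Or.inr fun h2 => h t ht ⟨h2, ?_⟩
          rwa [(isOpen_sphOmega C).interior_eq]
      · refine ⟨γ 0, ⟨0, ⟨le_rfl, by linarith⟩, rfl⟩, ?_⟩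
        have : γ 0 = u := Subtype.ext (by simp [γ, hv])
        rwa [this]
    exact hend (hsub ⟨T, ⟨by linarith, le_rfl⟩, rfl⟩)
  obtain ⟨t, ht, htf⟩ := hex
  refine ⟨γ t, htf, ?_⟩
  have hin : ⟪v, Real.cos t • v + Real.sin t • e⟫ = Real.cos t := by
    rw [inner_add_right, real_inner_smul_right, real_inner_smul_right, hvv, hue]; ring
  have hn : ‖((γ t : Metric.sphere (0 : EuclideanSpace ℝ (Fin d)) 1) :
    EuclideanSpace ℝ (Fin d))‖ = 1 := by simp
  rw [InnerProductGeometry.angle, hn, hu1]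
  change Real.arccos (⟪v, Real.cos t • v + Real.sin t • e⟫ / (1 * 1)) ≤ T
  rw [hin, mul_one, div_one, Real.arccos_cos ht.1 (by linarith [ht.2, Real.pi_pos])]
  exact ht.2

theorem angularDist_nonneg {d : ℕ} (C : Set (EuclideanSpace ℝ (Fin d)))
    (ω : Set (sphOmega C)) : 0 ≤ angularDist C ω := by
  refine Real.sInf_nonneg ?_
  rintro _ ⟨u, _, v, _, rfl⟩
  exact InnerProductGeometry.angle_nonneg _ _

theorem angularDist_le_angle {d : ℕ} {C : Set (EuclideanSpace ℝ (Fin d))}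
    {ω : Set (sphOmega C)} {u : sphOmega C} (hu : u ∈ ω)
    {v : Metric.sphere (0 : EuclideanSpace ℝ (Fin d)) 1} (hv : v ∈ frontier (sphOmega C)) :
    angularDist C ω ≤ InnerProductGeometry.angle (u.1.1 : EuclideanSpace ℝ (Fin d)) v := by
  refine csInf_le ⟨0, ?_⟩ ⟨u, hu, v, hv, rfl⟩
  rintro _ ⟨u, _, v, _, rfl⟩
  exact InnerProductGeometry.angle_nonneg _ _

/-- Vectors of `C` make an angle of at least `π / 2 + angularDist C ω` with every `u ∈ ω`; this is the
corresponding bound on inner products. -/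
theorem angularDist_mul_norm_le_neg_inner {d : ℕ} (hd : 2 ≤ d)
    {C : Set (EuclideanSpace ℝ (Fin d))} {ω : Set (sphOmega C)} {u : sphOmega C} (hu : u ∈ ω)
    {x : EuclideanSpace ℝ (Fin d)} (hx : x ∈ C) :
    2 / Real.pi * angularDist C ω * ‖x‖ ≤ -⟪x, (u.1.1 : EuclideanSpace ℝ (Fin d))⟫ := by
  rcases eq_or_ne x 0 with rfl | hx0
  · simp
  obtain ⟨v, hv, hle⟩ := exists_mem_frontier_sphOmega_angle_le hd u.2 hx hx0
  have hle' := (angularDist_le_angle hu hv).trans hle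
  set α := InnerProductGeometry.angle (u.1.1 : EuclideanSpace ℝ (Fin d)) x with hα
  have h0 := angularDist_nonneg C ω
  have hα2 : α ≤ Real.pi := InnerProductGeometry.angle_le_pi _ x
  -- Jordan's inequality on `[0, π / 2]` is the source of the factor `2 / π`
  have h1 := Real.mul_le_sin (h0.trans hle') (by linarith)
  rw [Real.sin_sub_pi_div_two] at h1
  have h2 := InnerProductGeometry.cos_angle_mul_norm_mul_norm
    (u.1.1 : EuclideanSpace ℝ (Fin d)) x
  have hu1 : ‖(u.1.1 : EuclideanSpace ℝ (Fin d))‖ = 1 := by simp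
  rw [hu1, one_mul, ← hα, real_inner_comm] at h2
  rw [← h2, ← neg_mul]
  refine mul_le_mul_of_nonneg_right (le_trans ?_ h1) (norm_nonneg _)
  exact mul_le_mul_of_nonneg_left hle' (by positivity)

theorem angularDist_singleton_pos {d : ℕ} {C : Set (EuclideanSpace ℝ (Fin d))}
    (hne : (frontier (sphOmega C)).Nonempty) (u : sphOmega C) : 0 < angularDist C {u} := by
  have hu1 : ‖(u.1.1 : EuclideanSpace ℝ (Fin d))‖ = 1 := by simp
  have hu0 : (u.1.1 : EuclideanSpace ℝ (Fin d)) ≠ 0 := by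
    rw [← norm_ne_zero_iff, hu1]; exact one_ne_zero
  have hset : {θ : ℝ | ∃ w ∈ ({u} : Set (sphOmega C)), ∃ v ∈ frontier (sphOmega C),
      θ = InnerProductGeometry.angle (w.1.1 : EuclideanSpace ℝ (Fin d)) v.1} =
      (fun v : Metric.sphere (0 : EuclideanSpace ℝ (Fin d)) 1 =>
        InnerProductGeometry.angle (u.1.1 : EuclideanSpace ℝ (Fin d)) v.1) ''
        frontier (sphOmega C) := by
    ext θ
    simp [eq_comm]
  have hcont : Continuous (fun v : Metric.sphere (0 : EuclideanSpace ℝ (Fin d)) 1 =>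
      InnerProductGeometry.angle (u.1.1 : EuclideanSpace ℝ (Fin d)) v.1) := by
    unfold InnerProductGeometry.angle
    simp only [norm_eq_of_mem_sphere]
    fun_prop
  have hmem := (isClosed_frontier.isCompact.image hcont).sInf_mem (hne.image _)
  rw [← hset] at hmem
  obtain ⟨w, rfl, v, hv, hθ⟩ := hmem
  rw [angularDist, hθ]
  refine lt_of_le_of_ne (InnerProductGeometry.angle_nonneg _ _) fun h => ?_
  obtain ⟨-, r, hr, hvr⟩ := InnerProductGeometry.angle_eq_zero_iff.1 h.symm
  have hr1 : r = 1 := by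
    have h1 : ‖(v : EuclideanSpace ℝ (Fin d))‖ = 1 := by simp
    rwa [hvr, norm_smul, hu1, mul_one, Real.norm_of_nonneg hr.le] at h1
  have hvw : v = w.1 := Subtype.ext (by rw [hvr, hr1, one_smul])
  rw [hvw, (isOpen_sphOmega C).frontier_eq] at hv
  exact hv.2 w.2

/-! ### Area of Lipschitz graphs over a hyperplane -/

/-- Let `u`, `v` be outer normal vectors at `x`, `y` of a set containing both points, and let `w` point
into the set, uniformly in the sense of `hwu` and `hwv`. Then neither point can be far above the other
in the direction of `w`, so their distance is controlled by that of their projections to `wᗮ`. -/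
theorem norm_sub_le_mul_norm_orthogonalProjectionOnto {E : Type*} [NormedAddCommGroup E]
    [InnerProductSpace ℝ E] {w x y u v : E} {r : ℝ} (hr : 0 < r) (hu : ‖u‖ = 1) (hv : ‖v‖ = 1)
    (hwu : ⟪w, u⟫ ≤ -r) (hwv : ⟪w, v⟫ ≤ -r) (hxu : ⟪y, u⟫ ≤ ⟪x, u⟫) (hyv : ⟪x, v⟫ ≤ ⟪y, v⟫) :
    ‖x - y‖ ≤ (1 + ‖w‖ / r) *
      ‖(ℝ ∙ w)ᗮ.orthogonalProjectionOnto x - (ℝ ∙ w)ᗮ.orthogonalProjectionOnto y‖ := by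
  rw [← map_sub]
  set p : E := (ℝ ∙ w)ᗮ.orthogonalProjectionOnto (x - y) with hp
  obtain ⟨s, hs⟩ : ∃ s : ℝ, x - y = p + s • w := by
    have h1 : x - y - p ∈ (ℝ ∙ w)ᗮᗮ := Submodule.sub_starProjection_mem_orthogonal _
    rw [Submodule.orthogonal_orthogonal] at h1
    obtain ⟨s, hs⟩ := Submodule.mem_span_singleton.1 h1
    exact ⟨s, by rw [hs]; abel⟩
  change ‖x - y‖ ≤ (1 + ‖w‖ / r) * ‖p‖
  have e1 : 0 ≤ ⟪p, u⟫ + s * ⟪w, u⟫ := by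
    rw [← real_inner_smul_left, ← inner_add_left, ← hs, inner_sub_left]; linarith
  have e2 : ⟪p, v⟫ + s * ⟪w, v⟫ ≤ 0 := by
    rw [← real_inner_smul_left, ← inner_add_left, ← hs, inner_sub_left]; linarith
  have b1 : ⟪p, u⟫ ≤ ‖p‖ := by simpa [hu] using real_inner_le_norm p u
  have b2 : -‖p‖ ≤ ⟪p, v⟫ := by
    simpa [hv] using neg_le_of_abs_le (abs_real_inner_le_norm p v)
  have hsr : |s| * r ≤ ‖p‖ := by
    rcases le_total 0 s with h | h
    · rw [abs_of_nonneg h]; nlinarith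
    · rw [abs_of_nonpos h]; nlinarith
  have hsr' : |s| ≤ ‖p‖ / r := (le_div_iff₀ hr).2 hsr
  calc ‖x - y‖ ≤ ‖p‖ + ‖s • w‖ := by rw [hs]; exact norm_add_le _ _
    _ = ‖p‖ + |s| * ‖w‖ := by rw [norm_smul, Real.norm_eq_abs]
    _ ≤ ‖p‖ + ‖p‖ / r * ‖w‖ := by gcongr
    _ = (1 + ‖w‖ / r) * ‖p‖ := by ring

/-- The area of a bounded Lipschitz graph over the hyperplane `wᗮ`, the graph condition being stated as
an inverse Lipschitz bound for the projection to `wᗮ`. -/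
theorem euclideanHausdorffMeasure_le_of_antilipschitz {d : ℕ}
    {w : EuclideanSpace ℝ (Fin d)} (hw : w ≠ 0) {L : ℝ≥0} {R : ℝ} (hR : 0 ≤ R)
    {s : Set (EuclideanSpace ℝ (Fin d))} (hsR : ∀ x ∈ s, ‖x‖ ≤ R)
    (hL : ∀ x ∈ s, ∀ y ∈ s, ‖x - y‖ ≤
      L * ‖(ℝ ∙ w)ᗮ.orthogonalProjectionOnto x - (ℝ ∙ w)ᗮ.orthogonalProjectionOnto y‖) :
    μHE[d - 1] s ≤ ENNReal.ofReal (R ^ (d - 1)) *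
      ((L : ℝ≥0∞) ^ (d - 1) * volume (Metric.ball (0 : (ℝ ∙ w)ᗮ) 1)) := by
  have hd0 : d ≠ 0 := by
    rintro rfl
    exact hw (Subsingleton.elim _ _)
  have : Fact (Module.finrank ℝ (EuclideanSpace ℝ (Fin d)) = (d - 1) + 1) :=
    ⟨by simp; omega⟩
  have hf : Module.finrank ℝ (ℝ ∙ w)ᗮ = d - 1 := Submodule.finrank_orthogonal_span_singleton hw
  let P : s → (ℝ ∙ w)ᗮ := fun x => (ℝ ∙ w)ᗮ.orthogonalProjectionOnto x.1
  have hP : AntilipschitzWith L P := by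
    refine AntilipschitzWith.of_le_mul_dist fun x y => ?_
    rw [Subtype.dist_eq, dist_eq_norm, dist_eq_norm]
    exact hL x x.2 y y.2
  have h1 : μH[((d - 1 : ℕ) : ℝ)] s ≤ (L : ℝ≥0∞) ^ (d - 1) *
      μH[((d - 1 : ℕ) : ℝ)] (P '' Set.univ) := by
    have h2 := hP.le_hausdorffMeasure_image (d := ((d - 1 : ℕ) : ℝ)) (by positivity) Set.univ
    rw [← (isometry_subtype_coe (s := s)).hausdorffMeasure_image (Or.inl (by positivity)),
      Set.image_univ, Subtype.range_coe, ENNReal.rpow_natCast] at h2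
    exact h2
  have h3 : P '' Set.univ ⊆ Metric.closedBall 0 R := by
    rintro _ ⟨x, -, rfl⟩
    rw [mem_closedBall_zero_iff]
    exact ((ℝ ∙ w)ᗮ.norm_orthogonalProjectionOnto_apply_le x.1).trans (hsR x x.2)
  calc μHE[d - 1] s ≤ (L : ℝ≥0∞) ^ (d - 1) * μHE[d - 1] (P '' Set.univ) := by
        simp only [Measure.euclideanHausdorffMeasure_def, Measure.smul_apply, ENNReal.smul_def,
          smul_eq_mul]
        rw [mul_left_comm]
        gcongr
    _ ≤ (L : ℝ≥0∞) ^ (d - 1) * μHE[d - 1] (Metric.closedBall (0 : (ℝ ∙ w)ᗮ) R) := by gcongr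
    _ = _ := by
        have hv : (μHE[d - 1] : Measure (ℝ ∙ w)ᗮ) = volume := by
          rw [← hf]; exact InnerProductSpace.euclideanHausdorffMeasure_eq_volume
        rw [hv, Measure.addHaar_closedBall _ _ hR, hf, mul_left_comm]

/-! ### Bounding the surface area -/

/-- The bound of the theorem, for arbitrary `ω ⊆ Ω_C` and nonempty closed `K ⊆ C`. -/
theorem exists_angularDist_pow_mul_surfaceArea_le {d : ℕ} (hd : 2 ≤ d)
    {C K : Set (EuclideanSpace ℝ (Fin d))} (hint : (interior C).Nonempty) (hK : K.Nonempty)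
    (hKC : K ⊆ C) (hclosed : IsClosed K) :
    ∃ M : ℝ≥0, ∀ ω : Set (sphOmega C),
      ENNReal.ofReal (angularDist C ω ^ (d - 1)) * surfaceArea K (Subtype.val '' ω) ≤ M := by
  obtain ⟨p, hp⟩ := hK
  obtain ⟨w, hw⟩ := hint
  obtain ⟨r, hr, hb⟩ := Metric.nhds_basis_closedBall.mem_iff.1 (mem_interior_iff_mem_nhds.1 hw)
  have hwu : ∀ u : sphOmega C, ⟪w, (u.1.1 : EuclideanSpace ℝ (Fin d))⟫ ≤ -r := fun u => by
    have h := inner_le_neg_mul_norm_of_closedBall (z := w)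
      (x := (u.1.1 : EuclideanSpace ℝ (Fin d))) hr.le fun y hy => by
        rw [real_inner_comm]; exact interior_subset u.2 y (hb hy)
    simpa using h
  have hLnonneg : 0 ≤ 1 + ‖w‖ / r := by positivity
  let L : ℝ≥0 := ⟨1 + ‖w‖ / r, hLnonneg⟩
  let B : ℝ≥0∞ := ENNReal.ofReal ((Real.pi / 2 * ‖p‖) ^ (d - 1)) *
    ((L : ℝ≥0∞) ^ (d - 1) * volume (Metric.ball (0 : (ℝ ∙ w)ᗮ) 1))
  have hB : B ≠ ∞ := ENNReal.mul_ne_top ENNReal.ofReal_ne_top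
    (ENNReal.mul_ne_top (ENNReal.pow_ne_top ENNReal.coe_ne_top) measure_ball_lt_top.ne)
  refine ⟨B.toNNReal, fun ω => ?_⟩
  rw [ENNReal.coe_toNNReal hB]
  rcases (angularDist_nonneg C ω).eq_or_lt with h0 | hΔ
  · rw [← h0, zero_pow (by omega)]
    simp
  set Δ := angularDist C ω with hΔdef
  rcases ω.eq_empty_or_nonempty with rfl | ⟨u₀, -⟩
  · simp [surfaceArea, reverseSphericalImage]
  have hw0 : w ≠ 0 := by
    rintro rfl
    have := hwu u₀
    simp at this
    linarith
  have hR : 0 ≤ Real.pi / 2 * ‖p‖ / Δ := by positivity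
  have hmain : surfaceArea K (Subtype.val '' ω) ≤
      ENNReal.ofReal ((Real.pi / 2 * ‖p‖ / Δ) ^ (d - 1)) *
      ((L : ℝ≥0∞) ^ (d - 1) * volume (Metric.ball (0 : (ℝ ∙ w)ᗮ) 1)) := by
    refine euclideanHausdorffMeasure_le_of_antilipschitz hw0 hR ?_ ?_
    · rintro x ⟨hxK, _, ⟨u, hu, rfl⟩, hsupp⟩
      have hx : x ∈ K := hclosed.frontier_subset hxK
      have h1 := angularDist_mul_norm_le_neg_inner hd hu (hKC hx)
      have h2 := hsupp p hp
      have h3 : -‖p‖ ≤ ⟪p, (u.1.1 : EuclideanSpace ℝ (Fin d))⟫ := by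
        simpa using neg_le_of_abs_le (abs_real_inner_le_norm p u.1.1)
      rw [le_div_iff₀ hΔ]
      have h4 : 2 / Real.pi * Δ * ‖x‖ ≤ ‖p‖ := by linarith
      calc ‖x‖ * Δ = Real.pi / 2 * (2 / Real.pi * Δ * ‖x‖) := by
            field_simp
        _ ≤ Real.pi / 2 * ‖p‖ := by gcongr
    · rintro x ⟨hxK, _, ⟨u, -, rfl⟩, hu⟩ y ⟨hyK, _, ⟨v, -, rfl⟩, hv⟩
      exact norm_sub_le_mul_norm_orthogonalProjectionOnto hr (by simp) (by simp) (hwu u) (hwu v)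
        (hu y (hclosed.frontier_subset hyK)) (hv x (hclosed.frontier_subset hxK))
  calc ENNReal.ofReal (Δ ^ (d - 1)) * surfaceArea K (Subtype.val '' ω)
      ≤ ENNReal.ofReal (Δ ^ (d - 1)) * (ENNReal.ofReal ((Real.pi / 2 * ‖p‖ / Δ) ^ (d - 1)) *
        ((L : ℝ≥0∞) ^ (d - 1) * volume (Metric.ball (0 : (ℝ ∙ w)ᗮ) 1))) := by gcongr
    _ = B := by
        rw [← mul_assoc, ← ENNReal.ofReal_mul (by positivity), ← mul_pow,
          mul_div_cancel₀ _ hΔ.ne']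

theorem IsSurfaceAreaMeasure.exists_bound {d : ℕ} (hd : 2 ≤ d)
    {C K : Set (EuclideanSpace ℝ (Fin d))} (hint : (interior C).Nonempty)
    (hK : IsConeAsymptotic C K) {φ : Measure (sphOmega C)} (hφ : IsSurfaceAreaMeasure C K φ) :
    ∃ M : ℝ≥0, ∀ ω : Set (sphOmega C), IsCompact ω →
      ENNReal.ofReal (angularDist C ω ^ (d - 1)) * φ ω ≤ M := by
  obtain ⟨M, hM⟩ :=
    exists_angularDist_pow_mul_surfaceArea_le hd hint hK.nonempty hK.subset hK.isClosed
  refine ⟨M, fun ω hω => ?_⟩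
  rw [hφ ω hω.measurableSet]
  exact hM ω

/-! ### A locally finite measure violating the bound -/

theorem exists_measure_lt_top_of_isCompact_not_bounded {d : ℕ}
    {C : Set (EuclideanSpace ℝ (Fin d))} (hne : (frontier (sphOmega C)).Nonempty) :
    ∃ φ : Measure (sphOmega C), (∀ ω : Set (sphOmega C), IsCompact ω → φ ω < ∞) ∧
      ∀ M : ℝ≥0, ∃ ω : Set (sphOmega C), IsCompact ω ∧
        M < ENNReal.ofReal (angularDist C ω ^ (d - 1)) * φ ω := by
  obtain ⟨v, hv⟩ := id hne
  have hvn : v ∉ sphOmega C := by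
    rw [(isOpen_sphOmega C).frontier_eq] at hv
    exact hv.2
  obtain ⟨a, haC, hav⟩ := mem_closure_iff_seq_limit.1 (frontier_subset_closure hv)
  let u : ℕ → sphOmega C := fun n => ⟨a n, haC n⟩
  let c : ℕ → ℝ≥0∞ := fun n => ENNReal.ofReal (n / angularDist C {u n} ^ (d - 1))
  refine ⟨Measure.sum fun n => c n • Measure.dirac (u n), fun ω hω => ?_, fun M => ?_⟩
  · rw [Measure.sum_apply _ hω.measurableSet]
    -- `u n` leaves the compact set `ω`, as its limit is outside `sphOmega C`
    have hev : ∀ᶠ n in atTop, u n ∉ ω := by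
      have hcl : IsClosed (Subtype.val '' ω) := (hω.image continuous_subtype_val).isClosed
      have hvω : v ∈ (Subtype.val '' ω)ᶜ := by
        rintro ⟨z, -, rfl⟩
        exact hvn z.2
      filter_upwards [hav.eventually (hcl.isOpen_compl.mem_nhds hvω)] with n hn hmem
      exact hn ⟨u n, hmem, rfl⟩
    obtain ⟨N, hN⟩ := eventually_atTop.1 hev
    rw [tsum_eq_sum (s := Finset.range N)]
    · refine ENNReal.sum_lt_top.2 fun n _ => ?_
      rw [Measure.smul_apply, smul_eq_mul]
      exact ENNReal.mul_lt_top ENNReal.ofReal_lt_top (measure_lt_top _ _)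
    · intro n hn
      have := hN n (by simpa using hn)
      rw [Measure.smul_apply, Measure.dirac_apply' _ hω.measurableSet]
      simp [this]
  · obtain ⟨n, hn⟩ := exists_nat_gt (M : ℝ)
    refine ⟨{u n}, isCompact_singleton, ?_⟩
    have hpos : 0 < angularDist C {u n} ^ (d - 1) := pow_pos (angularDist_singleton_pos hne _) _
    have hc : c n ≤ (Measure.sum fun n => c n • Measure.dirac (u n)) {u n} := by
      refine le_trans ?_ (Measure.le_sum_apply _ _)
      refine le_trans ?_ (ENNReal.le_tsum n)
      simp
    calc (M : ℝ≥0∞) < ENNReal.ofReal n := by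
          rw [ENNReal.lt_ofReal_iff_toReal_lt ENNReal.coe_ne_top]; simpa using hn
      _ = ENNReal.ofReal (angularDist C {u n} ^ (d - 1)) * c n := by
          rw [← ENNReal.ofReal_mul hpos.le, mul_div_cancel₀ _ hpos.ne']
      _ ≤ _ := by gcongr

theorem theorem4p1 {d : ℕ} (hd : 2 ≤ d) (C : ProperCone ℝ (EuclideanSpace ℝ (Fin d)))
    (hpointed : ∀ x ∈ C, -x ∈ C → x = 0)
    (hint : (interior (C : Set (EuclideanSpace ℝ (Fin d)))).Nonempty) :
    (∀ φ : Measure (sphOmega (C : Set (EuclideanSpace ℝ (Fin d)))),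
      (∃ K : Set (EuclideanSpace ℝ (Fin d)),
        IsConeAsymptotic (C : Set (EuclideanSpace ℝ (Fin d))) K ∧
        IsSurfaceAreaMeasure (C : Set (EuclideanSpace ℝ (Fin d))) K φ) →
      ∃ M : ℝ≥0, ∀ ω : Set (sphOmega (C : Set (EuclideanSpace ℝ (Fin d)))), IsCompact ω →
        ENNReal.ofReal (angularDist (C : Set (EuclideanSpace ℝ (Fin d))) ω ^ (d - 1)) * φ ω ≤ M) ∧
    (∃ φ : Measure (sphOmega (C : Set (EuclideanSpace ℝ (Fin d)))),
      (∀ ω : Set (sphOmega (C : Set (EuclideanSpace ℝ (Fin d)))), IsCompact ω → φ ω < ∞) ∧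
      ¬ ∃ K : Set (EuclideanSpace ℝ (Fin d)),
        IsConeAsymptotic (C : Set (EuclideanSpace ℝ (Fin d))) K ∧
        IsSurfaceAreaMeasure (C : Set (EuclideanSpace ℝ (Fin d))) K φ) := by
  refine ⟨fun φ ⟨K, hK, hφ⟩ => hφ.exists_bound hd hint hK, ?_⟩
  obtain ⟨x, hx, hx0⟩ := exists_ne_zero_mem_of_nonempty_interior hd hint
  obtain ⟨u, hu⟩ := nonempty_sphOmega C hpointed hx hx0
  obtain ⟨v, hv, -⟩ := exists_mem_frontier_sphOmega_angle_le hd hu hx hx0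
  obtain ⟨φ, hfin, hunb⟩ := exists_measure_lt_top_of_isCompact_not_bounded ⟨v, hv⟩
  refine ⟨φ, hfin, fun ⟨K, hK, hφ⟩ => ?_⟩
  obtain ⟨M, hM⟩ := hφ.exists_bound hd hint hK
  obtain ⟨ω, hω, hlt⟩ := hunb M
  exact hlt.not_ge (hM ω hω)
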